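/- Let $N\ge 2$, let $A\in\mathbb{R}^{N\times N}$ be symmetric positive definite with distinct eigenvalues $0<\lambda_1<\dots<\lambda_N$ and an associated orthonormal basis of eigenvectors $v_1,\dots,v_N$, let $\kappa=\lambda_N/\lambda_1$, let $b\in\mathbb{R}^N$, let $x_*$ be the solution of $Ax=b$, and let $f(x)=\frac12 x^\intercal Ax-b^\intercal x$. Let $\{x_n\}_{n\ge 0}$ be generated by the minimal gradient (MG) method \[ x_{n+1}=x_n-\alpha_n g_n,\qquad g_n=\nabla f(x_n)=Ax_n-b,\qquad \alpha_n=\frac{g_n^\intercal Ag_n}{g_n^\intercal A^2g_n}, \] and write $g_n=\sum_{i=1}^N\zeta_{i,n}v_i$. Assume that $\zeta_{1,0}\ne 0$ and $\zeta_{N,0}\ne 0$. Then there is a constant $c\ne 0$ such that the weights $p_{i,n}=\lambda_i\zeta_{i,n}^2\big/\sum_{j=1}^N\lambda_j\zeta_{j,n}^2$ satisfy \[ \lim_{n\to\infty}p_{i,2n}=\begin{cases}\frac{1}{1+c^2},& i=1,\\ 0,& 1<i<N,\\ \frac{c^2}{1+c^2},& i=N,\end{cases} \qquad \lim_{n\to\infty}p_{i,2n+1}=\begin{cases}\frac{c^2}{1+c^2},&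 i=1,\\ 0,& 1<i<N,\\ \frac{1}{1+c^2},& i=N\end{cases} \] (which determines $c^2$), and with this $c$ the following hold: \[ \lim_{n\to\infty}\frac{f(x_{2n+1})-f(x_*)}{f(x_{2n})-f(x_*)}=\frac{c^2(1+c^2\kappa^2)(\kappa-1)^2}{(c^2+\kappa^2)(1+c^2\kappa)^2}, \] \[ \lim_{n\to\infty}\frac{f(x_{2n+2})-f(x_*)}{f(x_{2n+1})-f(x_*)}=\frac{c^2(c^2+\kappa^2)(\kappa-1)^2}{(1+c^2\kappa^2)(c^2+\kappa)^2}, \] and both of the following limits exist and are equal: \[ \lim_{n\to\infty}\frac{f(x_{2n+2})-f(x_*)}{f(x_{2n})-f(x_*)}=\lim_{n\to\infty}\frac{\|g_{n+1}\|^4}{\|g_n\|^4}. \] -/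

import Mathlib

open Filter Topology

noncomputable section

namespace MinimalGradient

variable {N : ℕ}

/-- Action of an `N × N` real matrix on Euclidean space. -/
def act (A : Matrix (Fin N) (Fin N) ℝ) (x : EuclideanSpace ℝ (Fin N)) :
    EuclideanSpace ℝ (Fin N) :=
  WithLp.toLp 2 (A.mulVec x.ofLp)

/-- The quadratic objective `f(x) = ½ xᵀ A x - bᵀ x`. -/
def objective (A : Matrix (Fin N) (Fin N) ℝ) (b x : EuclideanSpace ℝ (Fin N)) : ℝ :=
  1 / 2 * inner ℝ x (act A x) - inner ℝ b x

/-- The gradient `g = ∇f(x) = A x - b`. -/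
def grad (A : Matrix (Fin N) (Fin N) ℝ) (b x : EuclideanSpace ℝ (Fin N)) :
    EuclideanSpace ℝ (Fin N) :=
  act A x - b

/-- The minimal gradient steplength `gᵀ A g / gᵀ A² g`. -/
def mgStep (A : Matrix (Fin N) (Fin N) ℝ) (g : EuclideanSpace ℝ (Fin N)) : ℝ :=
  inner ℝ g (act A g) / inner ℝ g (act (A ^ 2) g)

/-- The sequence `x` is generated by the minimal gradient method for `A x = b`. -/
def IsMGSequence (A : Matrix (Fin N) (Fin N) ℝ) (b : EuclideanSpace ℝ (Fin N))
    (x : ℕ → EuclideanSpace ℝ (Fin N)) : Prop :=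
  ∀ n, x (n + 1) = x n - mgStep A (grad A b (x n)) • grad A b (x n)

/-- The weight `λᵢ ζᵢ² / ∑ⱼ λⱼ ζⱼ²` of the `i`-th eigencomponent, where `ζⱼ` are the
coordinates of `g` in the orthonormal basis `v`. -/
def spectralWeight (lam : Fin N → ℝ)
    (v : OrthonormalBasis (Fin N) ℝ (EuclideanSpace ℝ (Fin N)))
    (g : EuclideanSpace ℝ (Fin N)) (i : Fin N) : ℝ :=
  lam i * (v.repr g i) ^ 2 / ∑ j, lam j * (v.repr g j) ^ 2

/-- `c` is the constant of the asymptotic spectral behaviour of the gradients `g n`: along even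
`n` the weights tend to `1 / (1 + c²)` for the smallest eigenvalue, `c² / (1 + c²)` for the
largest one, and `0` for the others; along odd `n` the two nonzero limits are swapped.
This determines `c²`. -/
def IsSpectralConstant (lam : Fin N → ℝ)
    (v : OrthonormalBasis (Fin N) ℝ (EuclideanSpace ℝ (Fin N)))
    (g : ℕ → EuclideanSpace ℝ (Fin N)) (c : ℝ) : Prop :=
  (∀ i : Fin N, Tendsto (fun n : ℕ => spectralWeight lam v (g (2 * n)) i) atTop
    (𝓝 (if i.val = 0 then 1 / (1 + c ^ 2)
        else if i.val = N - 1 then c ^ 2 / (1 + c ^ 2) else 0))) ∧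
  (∀ i : Fin N, Tendsto (fun n : ℕ => spectralWeight lam v (g (2 * n + 1)) i) atTop
    (𝓝 (if i.val = 0 then c ^ 2 / (1 + c ^ 2)
        else if i.val = N - 1 then 1 / (1 + c ^ 2) else 0)))

end MinimalGradient

end

namespace MinimalGradient

/-! In eigencoordinates an MG step multiplies `ζᵢ` by `1 - λᵢ / m`, with `m` the mean of `λ` under
the weights `p`, so the weights evolve autonomously by `T = reweight`. The variance `V` is a
Lyapunov function: `D = deviationProd` has `p`-mean `V(p)` and second moment `V(p) V(Tp)`, hence
`V(p) ≤ V(Tp)` (`variance_le_variance_reweight`).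

At a cluster point equality holds, so `D` is constant on the support. Being a monic quadratic in
`λ`, it leaves exactly two support points (`exists_support_pair`), which `T` swaps. For a given
limiting variance only finitely many such weights exist, and `T²` fixes them, so two-step increments
vanish and the even iterates converge (`exists_tendsto_of_finite_clusterPts`). An extreme eigenvalue
outside the support would have its weight eventually increasing along even indices, yet tending to
`0` (`ne_zero_of_variance_lt_deviationProd`).

Both `f - f(x_*)` and `‖g‖²` have the form `∑ hᵢ λᵢ ζᵢ²`; their one-step ratios are continuous
functions of the weights (`rate`), whose limits `tendsto_rate` evaluates. -/

variable {ι : Type*} [Fintype ι]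

/-! ### Reweighting and the monotonicity of the variance -/

/-- The mean of `lam` under the weights `p`. -/
noncomputable def mean (lam p : ι → ℝ) : ℝ := ∑ i, p i * lam i

/-- The variance of `lam` under the weights `p`. -/
noncomputable def variance (lam p : ι → ℝ) : ℝ := ∑ i, p i * (lam i - mean lam p) ^ 2

/-- The weights obtained by multiplying `p` by the squared deviation from the mean. -/
noncomputable def reweight (lam p : ι → ℝ) (i : ι) : ℝ :=
  p i * (lam i - mean lam p) ^ 2 / variance lam p

/-- The product of the deviations of `lam i` from the means before and after reweighting. -/
noncomputable def deviationProd (lam p : ι → ℝ) (i : ι) : ℝ :=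
  (lam i - mean lam p) * (lam i - mean lam (reweight lam p))

theorem continuous_mean (lam : ι → ℝ) : Continuous (mean lam) := by
  unfold mean; fun_prop

theorem continuous_variance (lam : ι → ℝ) : Continuous (variance lam) := by
  have := continuous_mean lam
  unfold variance; fun_prop

theorem continuousAt_reweight {lam p : ι → ℝ} (h : variance lam p ≠ 0) :
    ContinuousAt (reweight lam) p := by
  have h1 := continuous_mean lam
  have h2 := continuous_variance lam
  refine continuousAt_pi.2 fun i => ?_
  unfold reweight
  exact ContinuousAt.div (by fun_prop) h2.continuousAt h

theorem continuousAt_deviationProd {lam p : ι → ℝ} (h : variance lam p ≠ 0) (i : ι) :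
    ContinuousAt (fun p => deviationProd lam p i) p := by
  have h1 := (continuous_mean lam).continuousAt (x := p)
  have h2 : ContinuousAt (fun p => mean lam (reweight lam p)) p :=
    (continuous_mean lam).continuousAt.comp (continuousAt_reweight h)
  unfold deviationProd
  fun_prop

theorem sum_mul_sub_mean {lam p : ι → ℝ} (hp : ∑ i, p i = 1) :
    ∑ i, p i * (lam i - mean lam p) = 0 := by
  simp only [mul_sub, Finset.sum_sub_distrib, ← Finset.sum_mul, hp, one_mul]
  simp [mean]

theorem variance_nonneg {lam p : ι → ℝ} (hp : ∀ i, 0 ≤ p i) : 0 ≤ variance lam p :=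
  Finset.sum_nonneg fun i _ => mul_nonneg (hp i) (sq_nonneg _)

theorem variance_mul_variance_reweight {lam p : ι → ℝ} (h : variance lam p ≠ 0) :
    variance lam p * variance lam (reweight lam p) = ∑ i, p i * deviationProd lam p i ^ 2 := by
  rw [variance.eq_1 lam (reweight lam p), Finset.mul_sum]
  refine Finset.sum_congr rfl fun i _ => ?_
  rw [reweight, deviationProd]
  field_simp

theorem sum_mul_deviationProd {lam p : ι → ℝ} (hp : ∑ i, p i = 1) :
    ∑ i, p i * deviationProd lam p i = variance lam p := by
  have h1 := sum_mul_sub_mean (lam := lam) hp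
  have : ∀ i, p i * deviationProd lam p i = p i * (lam i - mean lam p) ^ 2 +
      (mean lam p - mean lam (reweight lam p)) * (p i * (lam i - mean lam p)) := by
    intro i; rw [deviationProd]; ring
  rw [Finset.sum_congr rfl fun i _ => this i, Finset.sum_add_distrib, ← Finset.mul_sum, h1]
  simp [variance]

/-- The left side is the `p`-variance of `deviationProd`, expanded by its first two moments; its
sign gives monotonicity and its vanishing the equality case. -/
theorem sum_mul_deviationProd_sub_sq {lam p : ι → ℝ} (hp : ∑ i, p i = 1)
    (h : variance lam p ≠ 0) :
    ∑ i, p i * (deviationProd lam p i - variance lam p) ^ 2 =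
      variance lam p * (variance lam (reweight lam p) - variance lam p) := by
  have : ∀ i, p i * (deviationProd lam p i - variance lam p) ^ 2 =
      p i * deviationProd lam p i ^ 2 - 2 * variance lam p * (p i * deviationProd lam p i) +
        variance lam p ^ 2 * p i := by
    intro i; ring
  rw [Finset.sum_congr rfl fun i _ => this i, Finset.sum_add_distrib, Finset.sum_sub_distrib,
    ← Finset.mul_sum, ← Finset.mul_sum, hp, sum_mul_deviationProd hp,
    ← variance_mul_variance_reweight h]
  ring

theorem variance_le_variance_reweight {lam p : ι → ℝ} (hp0 : ∀ i, 0 ≤ p i) (hp : ∑ i, p i = 1)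
    (h : variance lam p ≠ 0) : variance lam p ≤ variance lam (reweight lam p) := by
  have h1 := sum_mul_deviationProd_sub_sq hp h
  have h2 : 0 ≤ ∑ i, p i * (deviationProd lam p i - variance lam p) ^ 2 :=
    Finset.sum_nonneg fun i _ => mul_nonneg (hp0 i) (sq_nonneg _)
  rw [h1] at h2
  have := nonneg_of_mul_nonneg_right h2 (lt_of_le_of_ne (variance_nonneg hp0) h.symm)
  linarith

theorem deviationProd_eq_variance {lam q : ι → ℝ} (hq0 : ∀ i, 0 ≤ q i) (hq : ∑ i, q i = 1)
    (h : variance lam q ≠ 0) (hT : variance lam (reweight lam q) = variance lam q) {i : ι}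
    (hi : q i ≠ 0) : deviationProd lam q i = variance lam q := by
  have h1 := sum_mul_deviationProd_sub_sq hq h
  rw [hT, sub_self, mul_zero,
    Finset.sum_eq_zero_iff_of_nonneg fun i _ => mul_nonneg (hq0 i) (sq_nonneg _)] at h1
  have := h1 i (Finset.mem_univ _)
  simp only [mul_eq_zero, hi, false_or, ne_eq, OfNat.ofNat_ne_zero, not_false_eq_true,
    pow_eq_zero_iff] at this
  linarith

theorem reweight_reweight_apply (lam p : ι → ℝ) (i : ι) :
    reweight lam (reweight lam p) i =
      p i * (deviationProd lam p i ^ 2 / (variance lam p * variance lam (reweight lam p))) := by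
  rw [reweight.eq_1 lam (reweight lam p), reweight.eq_1 lam p, deviationProd]
  ring

theorem reweight_reweight_eq_self {lam q : ι → ℝ} (hq0 : ∀ i, 0 ≤ q i) (hq : ∑ i, q i = 1)
    (h : variance lam q ≠ 0) (hT : variance lam (reweight lam q) = variance lam q) :
    reweight lam (reweight lam q) = q := by
  ext i
  rw [reweight_reweight_apply]
  by_cases hi : q i = 0
  · simp [hi]
  · rw [deviationProd_eq_variance hq0 hq h hT hi, hT]
    field_simp

/-! ### The equality case: two-point weights -/

/-- Weights whose variance is kept by reweighting are carried by exactly two points. -/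
theorem exists_support_pair {lam q : ι → ℝ} (hlam : Function.Injective lam)
    (hq0 : ∀ i, 0 ≤ q i) (hq : ∑ i, q i = 1)
    (h : variance lam q ≠ 0) (hT : variance lam (reweight lam q) = variance lam q) :
    ∃ i j, lam i < lam j ∧ q i ≠ 0 ∧ q j ≠ 0 ∧ (∀ k, k ≠ i → k ≠ j → q k = 0) ∧
      ∀ k, deviationProd lam q k - variance lam q = (lam k - lam i) * (lam k - lam j) := by
  obtain ⟨i, hi⟩ : ∃ i, q i ≠ 0 := by
    by_contra! hc
    simp [hc] at hq
  obtain ⟨j, hji, hj⟩ : ∃ j, j ≠ i ∧ q j ≠ 0 := by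
    by_contra! hc
    have hqi : q i = 1 := by
      rw [← hq, Finset.sum_eq_single i (fun k _ hk => hc k hk) (by simp)]
    have hm : mean lam q = lam i := by
      rw [mean, Finset.sum_eq_single i (fun k _ hk => by simp [hc k hk]) (by simp), hqi, one_mul]
    apply h
    rw [variance, Finset.sum_eq_single i (fun k _ hk => by simp [hc k hk]) (by simp), hm]
    simp
  have hfac : ∀ i j, i ≠ j → q i ≠ 0 → q j ≠ 0 → ∀ k,
      deviationProd lam q k - variance lam q = (lam k - lam i) * (lam k - lam j) := by
    intro i j hij hi hj k
    have h1 := deviationProd_eq_variance hq0 hq h hT hi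
    have h2 := deviationProd_eq_variance hq0 hq h hT hj
    have hne : lam i - lam j ≠ 0 := sub_ne_zero.2 fun e => hij (hlam e)
    unfold deviationProd at h1 h2 ⊢
    -- `D - V` is a monic quadratic in `λ` vanishing at `lam i` and `lam j`; this compares the sums
    -- of its roots.
    have h3 : mean lam q + mean lam (reweight lam q) = lam i + lam j := by
      apply mul_left_cancel₀ hne
      linear_combination h2 - h1
    linear_combination h1 + (lam i - lam k) * h3
  have hz : ∀ k, k ≠ i → k ≠ j → q k = 0 := by
    intro k hki hkj
    by_contra hk
    have h1 := hfac i j hji.symm hi hj k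
    rw [deviationProd_eq_variance hq0 hq h hT hk, sub_self, eq_comm, mul_eq_zero, sub_eq_zero,
      sub_eq_zero] at h1
    exact h1.elim (fun e => hki (hlam e)) (fun e => hkj (hlam e))
  rcases lt_or_gt_of_ne (hlam.ne hji) with hlt | hlt
  · exact ⟨j, i, hlt, hj, hi, fun k h1 h2 => hz k h2 h1, hfac j i hji hj hi⟩
  · exact ⟨i, j, hlt, hi, hj, hz, hfac i j hji.symm hi hj⟩

theorem sum_eq_add_of_support {q : ι → ℝ} {i j : ι} (hij : i ≠ j)
    (hz : ∀ k, k ≠ i → k ≠ j → q k = 0) (F : ι → ℝ) :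
    ∑ k, q k * F k = q i * F i + q j * F j := by
  classical
  rw [Finset.sum_eq_add i j hij (fun k _ hk => by simp [hz k hk.1 hk.2]) (by simp) (by simp)]

theorem add_eq_one_of_support {q : ι → ℝ} {i j : ι} (hij : i ≠ j)
    (hz : ∀ k, k ≠ i → k ≠ j → q k = 0) (hq : ∑ i, q i = 1) : q i + q j = 1 := by
  simpa [hq, eq_comm] using sum_eq_add_of_support hij hz fun _ => 1

theorem variance_of_support {lam q : ι → ℝ} {i j : ι} (hij : i ≠ j)
    (hz : ∀ k, k ≠ i → k ≠ j → q k = 0) (hq : ∑ i, q i = 1) :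
    variance lam q = q i * q j * (lam i - lam j) ^ 2 := by
  have h1 := add_eq_one_of_support hij hz hq
  rw [variance, mean, sum_eq_add_of_support hij hz, sum_eq_add_of_support hij hz,
    eq_sub_of_add_eq' h1]
  ring

theorem reweight_of_support {lam q : ι → ℝ} {i j : ι} (hij : i ≠ j)
    (hz : ∀ k, k ≠ i → k ≠ j → q k = 0) (hq : ∑ i, q i = 1) (h : variance lam q ≠ 0) :
    reweight lam q i = q j ∧ reweight lam q j = q i := by
  have h1 := add_eq_one_of_support hij hz hq
  have hm : mean lam q = q i * lam i + q j * lam j := sum_eq_add_of_support hij hz _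
  have hV := variance_of_support (lam := lam) hij hz hq
  constructor
  · rw [reweight, div_eq_iff h, hV, hm, eq_sub_of_add_eq' h1]; ring
  · rw [reweight, div_eq_iff h, hV, hm, eq_sub_of_add_eq' h1]; ring

theorem finite_setOf_mul_one_sub {d V : ℝ} (hd : d ≠ 0) : {t : ℝ | t * (1 - t) * d = V}.Finite := by
  rcases Set.eq_empty_or_nonempty {t : ℝ | t * (1 - t) * d = V} with he | ⟨s, hs⟩
  · rw [he]; exact Set.finite_empty
  · refine Set.Finite.subset (Set.toFinite {s, 1 - s}) fun t ht => ?_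
    simp only [Set.mem_ofPred_eq] at hs ht
    have : (t - s) * (t - (1 - s)) = 0 := by
      apply mul_left_cancel₀ hd
      linear_combination hs - ht
    rcases mul_eq_zero.1 this with h | h
    · exact Or.inl (sub_eq_zero.1 h)
    · exact Or.inr (sub_eq_zero.1 h)

/-- The support is a pair, and `V = t (1 - t) (lam i - lam j)²` leaves at most two values of `t` for
each pair. Finiteness makes the cluster points isolated. -/
theorem finite_fixedVariance {lam : ι → ℝ} (hlam : Function.Injective lam) {V : ℝ} (hV : V ≠ 0) :
    {q : ι → ℝ | (∀ i, 0 ≤ q i) ∧ ∑ i, q i = 1 ∧ variance lam q = V ∧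
      variance lam (reweight lam q) = V}.Finite := by
  have hfin : (⋃ i, ⋃ j, {t : ℝ | lam i ≠ lam j ∧ t * (1 - t) * (lam i - lam j) ^ 2 = V}).Finite := by
    refine Set.finite_iUnion fun i => Set.finite_iUnion fun j => ?_
    by_cases hij : lam i = lam j
    · simp [hij]
    · simpa [hij] using finite_setOf_mul_one_sub (V := V) (pow_ne_zero 2 (sub_ne_zero.2 hij))
  refine (Set.Finite.pi' fun _ : ι => hfin.insert 0).subset fun q hq => ?_
  obtain ⟨hq0, hq1, hqV, hqT⟩ := hq
  have hV' : variance lam q ≠ 0 := by rwa [hqV]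
  obtain ⟨i, j, hij, -, -, hz, -⟩ := exists_support_pair hlam hq0 hq1 hV' (hqT.trans hqV.symm)
  have hne : i ≠ j := fun e => by simp [e] at hij
  have h1 := add_eq_one_of_support hne hz hq1
  have hv := variance_of_support (lam := lam) hne hz hq1
  intro k
  by_cases hki : k = i
  · right
    simp only [Set.mem_iUnion]
    refine ⟨i, j, hij.ne, ?_⟩
    rw [hki, ← hqV, hv, eq_sub_of_add_eq' h1]
  · by_cases hkj : k = j
    · right
      simp only [Set.mem_iUnion]
      refine ⟨i, j, hij.ne, ?_⟩
      rw [hkj, ← hqV, hv, eq_sub_of_add_eq h1]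
      ring
    · exact Or.inl (hz k hki hkj)

/-! ### Convergence of the weights to the two extreme points -/

/-- Around an isolated cluster point lies an annulus that the sequence eventually avoids; steps
shorter than its width cannot jump across it. -/
theorem exists_tendsto_of_finite_clusterPts {X : Type*} [MetricSpace X] {u : ℕ → X} {K S : Set X}
    (hK : IsCompact K) (hu : ∀ n, u n ∈ K) (hS : S.Finite)
    (hclu : ∀ (φ : ℕ → ℕ) (a : X), StrictMono φ → Tendsto (u ∘ φ) atTop (𝓝 a) → a ∈ S)
    (hstep : Tendsto (fun n => dist (u (n + 1)) (u n)) atTop (𝓝 0)) :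
    ∃ s ∈ S, Tendsto u atTop (𝓝 s) := by
  obtain ⟨s, -, φ, hφ, hs⟩ := hK.tendsto_subseq hu
  have hsS := hclu φ s hφ hs
  refine ⟨s, hsS, ?_⟩
  obtain ⟨δ, hδ, hball⟩ : ∃ δ > 0, ∀ a ∈ S, dist a s < δ → a = s := by
    have hop : (S \ {s})ᶜ ∈ 𝓝 s :=
      (hS.subset Set.sdiff_subset).isClosed.isOpen_compl.mem_nhds (by simp)
    obtain ⟨δ, hδ, hsub⟩ := Metric.mem_nhds_iff.1 hop
    refine ⟨δ, hδ, fun a ha had => ?_⟩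
    by_contra hne
    exact hsub (Metric.mem_ball.2 had) ⟨ha, hne⟩
  rw [Metric.tendsto_atTop]
  intro η hη
  set ε := min η (δ / 3) with hε
  have hε0 : 0 < ε := lt_min hη (by positivity)
  have hεδ : 2 * ε < δ := by
    have := min_le_right η (δ / 3)
    rw [← hε] at this
    linarith
  -- Otherwise compactness gives a cluster point in the annulus, although `s` is the only one within
  -- `δ`.
  have hann : ∀ᶠ n in atTop, ¬ (ε ≤ dist (u n) s ∧ dist (u n) s ≤ 2 * ε) := by
    by_contra hc
    have hfreq : ∃ᶠ n in atTop, ε ≤ dist (u n) s ∧ dist (u n) s ≤ 2 * ε := fun h => hc h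
    obtain ⟨ψ, hψ, hψa⟩ := extraction_of_frequently_atTop hfreq
    obtain ⟨a, -, χ, hχ, ha⟩ := hK.tendsto_subseq fun n => hu (ψ n)
    have haS := hclu (ψ ∘ χ) a (hψ.comp hχ) ha
    have hd : Tendsto (fun n => dist (u (ψ (χ n))) s) atTop (𝓝 (dist a s)) :=
      Tendsto.dist ha tendsto_const_nhds
    have h1 : ε ≤ dist a s := ge_of_tendsto' hd fun n => (hψa _).1
    have h2 : dist a s ≤ 2 * ε := le_of_tendsto' hd fun n => (hψa _).2
    rw [hball a haS (by linarith), dist_self] at h1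
    linarith
  obtain ⟨M, hM⟩ := eventually_atTop.1
    (hann.and (hstep.eventually (gt_mem_nhds hε0)))
  obtain ⟨k, hkM, hk⟩ : ∃ k, M ≤ φ k ∧ dist (u (φ k)) s < ε := by
    have h1 := hφ.tendsto_atTop.eventually (eventually_ge_atTop M)
    have h2 := Metric.tendsto_atTop.1 hs ε hε0
    obtain ⟨K, hK⟩ := h2
    obtain ⟨k, hk1, hk2⟩ := (h1.and (eventually_ge_atTop K)).exists
    exact ⟨k, hk1, hK k hk2⟩
  refine ⟨φ k, fun n hn => lt_of_lt_of_le ?_ (min_le_left η (δ / 3))⟩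
  induction n, hn using Nat.le_induction with
  | base => exact hk
  | succ n hn ih =>
    by_contra hc
    have h1 := (hM n (hkM.trans hn)).2
    have h2 := (hM (n + 1) (by omega)).1
    have h3 := dist_triangle (u (n + 1)) (u n) s
    exact h2 ⟨not_lt.1 hc, by linarith⟩

theorem mean_mem_Ioo {lam p : ι → ℝ} {a b : ι} (hab : lam a < lam b)
    (ha : ∀ k, lam a ≤ lam k) (hb : ∀ k, lam k ≤ lam b)
    (hp0 : ∀ i, 0 ≤ p i) (hp : ∑ i, p i = 1) (hpa : 0 < p a) (hpb : 0 < p b) :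
    mean lam p ∈ Set.Ioo (lam a) (lam b) := by
  have key : ∀ c, mean lam p - c = ∑ k, p k * (lam k - c) := by
    intro c
    simp only [mul_sub, Finset.sum_sub_distrib, ← Finset.sum_mul, hp, one_mul]
    rfl
  constructor
  · have h1 : p b * (lam b - lam a) ≤ ∑ k, p k * (lam k - lam a) :=
      Finset.single_le_sum (f := fun k => p k * (lam k - lam a))
        (fun k _ => mul_nonneg (hp0 k) (sub_nonneg.2 (ha k))) (Finset.mem_univ b)
    rw [← key] at h1
    have := mul_pos hpb (sub_pos.2 hab)
    linarith
  · have h1 : p a * (lam b - lam a) ≤ ∑ k, p k * (lam b - lam k) :=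
      Finset.single_le_sum (f := fun k => p k * (lam b - lam k))
        (fun k _ => mul_nonneg (hp0 k) (sub_nonneg.2 (hb k))) (Finset.mem_univ a)
    have h2 := key (lam b)
    have h3 : ∑ k, p k * (lam b - lam k) = -∑ k, p k * (lam k - lam b) := by
      rw [← Finset.sum_neg_distrib]
      exact Finset.sum_congr rfl fun k _ => by ring
    have := mul_pos hpa (sub_pos.2 hab)
    linarith

theorem variance_pos {lam p : ι → ℝ} {i : ι} (hp0 : ∀ i, 0 ≤ p i) (hpi : 0 < p i)
    (hi : lam i ≠ mean lam p) : 0 < variance lam p := by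
  have h1 : p i * (lam i - mean lam p) ^ 2 ≤ variance lam p :=
    Finset.single_le_sum (f := fun k => p k * (lam k - mean lam p) ^ 2)
      (fun k _ => mul_nonneg (hp0 k) (sq_nonneg _)) (Finset.mem_univ i)
  have : 0 < (lam i - mean lam p) ^ 2 := by
    have := sub_ne_zero.2 hi
    positivity
  have := mul_pos hpi this
  linarith

/-- A component along which the deviation product exceeds the limiting variance cannot vanish
in the limit. -/
theorem ne_zero_of_variance_lt_deviationProd {lam q : ι → ℝ} {p : ℕ → ι → ℝ} {e : ι}
    (hrec : ∀ n, p (n + 1) = reweight lam (p n)) (hpos : ∀ n, 0 < p n e)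
    (hlim : Tendsto (fun n => p (2 * n)) atTop (𝓝 q)) (hV : 0 < variance lam q)
    (hT : variance lam (reweight lam q) = variance lam q)
    (he : variance lam q < deviationProd lam q e) : q e ≠ 0 := by
  have hc1 := (continuous_variance lam).continuousAt (x := q)
  have hc2 : ContinuousAt (fun r => variance lam (reweight lam r)) q :=
    (continuous_variance lam).continuousAt.comp (continuousAt_reweight hV.ne')
  have hc3 := continuousAt_deviationProd hV.ne' e
  have hR : ContinuousAt (fun r => deviationProd lam r e ^ 2 /
      (variance lam r * variance lam (reweight lam r))) q :=
    (hc3.pow 2).div (hc1.mul hc2) (by rw [hT]; positivity)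
  have hR1 : 1 < deviationProd lam q e ^ 2 /
      (variance lam q * variance lam (reweight lam q)) := by
    rw [hT, one_lt_div (by positivity)]
    nlinarith
  have hev := (hR.tendsto.comp hlim).eventually (lt_mem_nhds hR1)
  obtain ⟨M, hM⟩ := eventually_atTop.1 hev
  -- Two steps multiply the weight at `e` by a factor whose limit exceeds `1`.
  have hmono : ∀ n ≥ M, p (2 * M) e ≤ p (2 * n) e := by
    intro n hn
    induction n, hn using Nat.le_induction with
    | base => exact le_rfl
    | succ n hn ih =>
      have h1 := hM n hn
      simp only [Function.comp] at h1
      have h2 : p (2 * (n + 1)) = reweight lam (reweight lam (p (2 * n))) := by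
        rw [← hrec, ← hrec]; rfl
      rw [h2, reweight_reweight_apply]
      nlinarith [hpos (2 * n)]
  have hle : p (2 * M) e ≤ q e :=
    ge_of_tendsto ((continuous_apply e).continuousAt.tendsto.comp hlim)
      (eventually_atTop.2 ⟨M, hmono⟩)
  exact ((hpos _).trans_le hle).ne'

/-- Iterated reweighting converges along even indices to weights carried by the two extreme
points. -/
theorem exists_tendsto_reweight {lam : ι → ℝ} (hlam : Function.Injective lam) {a b : ι}
    (hab : lam a < lam b) (ha : ∀ k, lam a ≤ lam k) (hb : ∀ k, lam k ≤ lam b)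
    {p : ℕ → ι → ℝ} (hrec : ∀ n, p (n + 1) = reweight lam (p n))
    (hp0 : ∀ n i, 0 ≤ p n i) (hp : ∀ n, ∑ i, p n i = 1)
    (hpa : ∀ n, 0 < p n a) (hpb : ∀ n, 0 < p n b) :
    ∃ q : ι → ℝ, 0 < q a ∧ 0 < q b ∧ q a + q b = 1 ∧ (∀ k, k ≠ a → k ≠ b → q k = 0) ∧
      reweight lam q a = q b ∧ reweight lam q b = q a ∧
      Tendsto (fun n => p (2 * n)) atTop (𝓝 q) ∧
      Tendsto (fun n => p (2 * n + 1)) atTop (𝓝 (reweight lam q)) := by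
  have hVpos : ∀ n, 0 < variance lam (p n) := fun n =>
    variance_pos (hp0 n) (hpa n) (mean_mem_Ioo hab ha hb (hp0 n) (hp n) (hpa n) (hpb n)).1.ne
  have hVmono : Monotone fun n => variance lam (p n) := by
    refine monotone_nat_of_le_succ fun n => ?_
    rw [hrec]
    exact variance_le_variance_reweight (hp0 n) (hp n) (hVpos n).ne'
  have hK : IsCompact (stdSimplex ℝ ι) := isCompact_stdSimplex ℝ ι
  have hpK : ∀ n, p n ∈ stdSimplex ℝ ι := fun n => ⟨hp0 n, hp n⟩
  obtain ⟨V, hV⟩ : ∃ V, Tendsto (fun n => variance lam (p n)) atTop (𝓝 V) := by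
    obtain ⟨B, hB⟩ := hK.bddAbove_image (continuous_variance lam).continuousOn
    refine ⟨_, tendsto_atTop_ciSup hVmono ⟨B, ?_⟩⟩
    rintro _ ⟨n, rfl⟩
    exact hB ⟨p n, hpK n, rfl⟩
  have hV0 : 0 < V := (hVpos 0).trans_le (hVmono.ge_of_tendsto hV 0)
  have hclu : ∀ (φ : ℕ → ℕ) (q : ι → ℝ), Tendsto φ atTop atTop →
      Tendsto (p ∘ φ) atTop (𝓝 q) →
      (∀ i, 0 ≤ q i) ∧ ∑ i, q i = 1 ∧ variance lam q = V ∧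
        variance lam (reweight lam q) = V := by
    intro φ q hφ hq
    have hqK : q ∈ stdSimplex ℝ ι :=
      hK.isClosed.mem_of_tendsto hq (Eventually.of_forall fun n => hpK _)
    have h1 : variance lam q = V :=
      tendsto_nhds_unique (((continuous_variance lam).tendsto q).comp hq) (hV.comp hφ)
    have h2 : Tendsto (fun n => p (φ n + 1)) atTop (𝓝 (reweight lam q)) := by
      simp only [hrec]
      exact (continuousAt_reweight (by rw [h1]; exact hV0.ne')).tendsto.comp hq
    refine ⟨hqK.1, hqK.2, h1, ?_⟩
    exact tendsto_nhds_unique (((continuous_variance lam).tendsto _).comp h2)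
      (hV.comp (tendsto_atTop_mono (fun n => Nat.le_succ _) hφ))
  -- Every subsequence has a further one converging to a weight fixed by two reweightings.
  have hstep : Tendsto (fun n => dist (p (n + 2)) (p n)) atTop (𝓝 0) := by
    refine tendsto_of_subseq_tendsto fun ns hns => ?_
    obtain ⟨q, -, ψ, hψ, hq⟩ := hK.tendsto_subseq fun n => hpK (ns n)
    have hφ := hns.comp hψ.tendsto_atTop
    obtain ⟨h0, h1, h2, h3⟩ := hclu (ns ∘ ψ) q hφ hq
    have h4 : variance lam q ≠ 0 := by rw [h2]; exact hV0.ne'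
    have h5 : variance lam (reweight lam q) ≠ 0 := by rw [h3]; exact hV0.ne'
    refine ⟨ψ, ?_⟩
    have h6 : Tendsto (fun n => p (ns (ψ n) + 2)) atTop (𝓝 q) := by
      have := ((continuousAt_reweight h5).tendsto.comp (continuousAt_reweight h4).tendsto).comp hq
      rw [reweight_reweight_eq_self h0 h1 h4 (h3.trans h2.symm)] at this
      refine this.congr fun n => ?_
      simp only [Function.comp, ← hrec]
    simpa using h6.dist hq
  have h2n : Tendsto (fun n : ℕ => 2 * n) atTop atTop :=
    tendsto_id.const_mul_atTop' (by norm_num)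
  obtain ⟨q, ⟨hq0, hq1, hqV, hqT⟩, hq⟩ := exists_tendsto_of_finite_clusterPts
    (u := fun n => p (2 * n)) hK (fun n => hpK _) (finite_fixedVariance hlam hV0.ne')
    (fun φ r hφ hr => hclu (fun n => 2 * φ n) r (h2n.comp hφ.tendsto_atTop) hr)
    (hstep.comp h2n)
  have hqV0 : 0 < variance lam q := by rwa [hqV]
  have hT := hqT.trans hqV.symm
  obtain ⟨i, j, hij, hi, hj, hz, hfac⟩ := exists_support_pair hlam hq0 hq1 hqV0.ne' hT
  -- If `lam a < lam i < lam j`, both factors of `D - V` at `a` are negative, so `D` exceeds `V`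
  -- there.
  have hai : a = i := by
    by_contra hne
    have h1 : lam a < lam i := lt_of_le_of_ne (ha i) fun e => hne (hlam e)
    refine ne_zero_of_variance_lt_deviationProd hrec hpa hq hqV0 hT ?_ (hz a hne ?_)
    · have := hfac a
      nlinarith
    · rintro rfl
      exact absurd h1 hij.le.not_gt
  have hbj : b = j := by
    by_contra hne
    have h1 : lam j < lam b := lt_of_le_of_ne (hb j) fun e => hne (hlam e.symm)
    refine ne_zero_of_variance_lt_deviationProd hrec hpb hq hqV0 hT ?_ (hz b ?_ hne)
    · have := hfac b
      nlinarith
    · rintro rfl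
      exact absurd h1 hij.le.not_gt
  subst hai hbj
  have hne : a ≠ b := fun e => by simp [e] at hab
  have hsw := reweight_of_support hne hz hq1 hqV0.ne'
  refine ⟨q, lt_of_le_of_ne (hq0 _) hi.symm, lt_of_le_of_ne (hq0 _) hj.symm,
    add_eq_one_of_support hne hz hq1, hz, hsw.1, hsw.2, hq, ?_⟩
  simp only [hrec]
  exact (continuousAt_reweight hqV0.ne').tendsto.comp hq

/-! ### From gradient coordinates to weights and rates -/

/-- The normalized weights `lamᵢ zᵢ²`. -/
noncomputable def weight (lam z : ι → ℝ) (i : ι) : ℝ := lam i * z i ^ 2 / ∑ j, lam j * z j ^ 2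

/-- One minimal gradient step on the eigencoordinates `z` of the gradient. -/
noncomputable def mgCoord (lam z : ι → ℝ) (i : ι) : ℝ :=
  (1 - (∑ j, lam j * z j ^ 2) / (∑ j, lam j ^ 2 * z j ^ 2) * lam i) * z i

/-- The factor by which `∑ hᵢ lamᵢ zᵢ²` changes in a minimal gradient step with weights `p`. -/
noncomputable def rate (lam h p : ι → ℝ) : ℝ :=
  (∑ i, p i * (h i * (1 - lam i / mean lam p) ^ 2)) / ∑ i, p i * h i

theorem sum_mul_sq_pos {lam z : ι → ℝ} (hlam : ∀ i, 0 < lam i) {a : ι} (ha : z a ≠ 0) :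
    0 < ∑ j, lam j * z j ^ 2 :=
  Finset.sum_pos' (fun j _ => mul_nonneg (hlam j).le (sq_nonneg _))
    ⟨a, Finset.mem_univ _, mul_pos (hlam a) (by positivity)⟩

theorem sum_weight {lam z : ι → ℝ} (hW : ∑ j, lam j * z j ^ 2 ≠ 0) : ∑ i, weight lam z i = 1 := by
  simp only [weight, ← Finset.sum_div]
  exact div_self hW

theorem weight_nonneg {lam z : ι → ℝ} (hlam : ∀ i, 0 < lam i) (i : ι) : 0 ≤ weight lam z i :=
  div_nonneg (mul_nonneg (hlam i).le (sq_nonneg _))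
    (Finset.sum_nonneg fun j _ => mul_nonneg (hlam j).le (sq_nonneg _))

theorem weight_pos {lam z : ι → ℝ} (hlam : ∀ i, 0 < lam i) {i : ι} (hi : z i ≠ 0) :
    0 < weight lam z i :=
  div_pos (mul_pos (hlam i) (by positivity)) (sum_mul_sq_pos hlam hi)

theorem mgCoord_eq (lam z : ι → ℝ) (i : ι) :
    mgCoord lam z i = (1 - lam i / mean lam (weight lam z)) * z i := by
  have : mean lam (weight lam z) = (∑ j, lam j ^ 2 * z j ^ 2) / ∑ j, lam j * z j ^ 2 := by
    rw [mean, Finset.sum_div]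
    exact Finset.sum_congr rfl fun i _ => by rw [weight]; ring
  rw [this, mgCoord, div_div_eq_mul_div]
  ring

theorem weight_mgCoord {lam z : ι → ℝ} (hW : ∑ j, lam j * z j ^ 2 ≠ 0)
    (hm : mean lam (weight lam z) ≠ 0) :
    weight lam (mgCoord lam z) = reweight lam (weight lam z) := by
  have h1 : ∀ i, lam i * mgCoord lam z i ^ 2 =
      (∑ j, lam j * z j ^ 2) / mean lam (weight lam z) ^ 2 *
        (weight lam z i * (lam i - mean lam (weight lam z)) ^ 2) := by
    intro i
    rw [mgCoord_eq]
    generalize mean lam (weight lam z) = m at *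
    rw [weight]
    field_simp
    ring
  ext i
  rw [weight, reweight, variance, h1, Finset.sum_congr rfl fun i _ => h1 i, ← Finset.mul_sum,
    mul_div_mul_left _ _ (div_ne_zero hW (pow_ne_zero 2 hm))]

theorem sum_mgCoord_div_sum {lam z : ι → ℝ} (hW : ∑ j, lam j * z j ^ 2 ≠ 0) (h : ι → ℝ) :
    (∑ i, h i * (lam i * mgCoord lam z i ^ 2)) / ∑ i, h i * (lam i * z i ^ 2) =
      rate lam h (weight lam z) := by
  have h1 : ∀ i, weight lam z i * (h i * (1 - lam i / mean lam (weight lam z)) ^ 2) =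
      (∑ j, lam j * z j ^ 2)⁻¹ * (h i * (lam i * mgCoord lam z i ^ 2)) := by
    intro i
    rw [mgCoord_eq]
    generalize mean lam (weight lam z) = m at *
    rw [weight]
    ring
  have h2 : ∀ i, weight lam z i * h i =
      (∑ j, lam j * z j ^ 2)⁻¹ * (h i * (lam i * z i ^ 2)) := by
    intro i
    rw [weight]
    ring
  rw [rate, Finset.sum_congr rfl fun i _ => h1 i, Finset.sum_congr rfl fun i _ => h2 i,
    ← Finset.mul_sum, ← Finset.mul_sum, mul_div_mul_left _ _ (inv_ne_zero hW)]

theorem continuousAt_rate {lam h p : ι → ℝ} (hm : mean lam p ≠ 0) (hs : ∑ i, p i * h i ≠ 0) :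
    ContinuousAt (rate lam h) p := by
  have h1 := (continuous_mean lam).continuousAt (x := p)
  have h2 : ContinuousAt (fun p => ∑ i, p i * (h i * (1 - lam i / mean lam p) ^ 2)) p := by
    refine tendsto_finsetSum _ fun i _ => ?_
    have h3 : ContinuousAt (fun p => lam i / mean lam p) p := continuousAt_const.div h1 hm
    have h4 : ContinuousAt (fun p : ι → ℝ => p i) p := (continuous_apply i).continuousAt
    exact h4.mul (continuousAt_const.mul ((continuousAt_const.sub h3).pow 2))
  refine h2.div (tendsto_finsetSum _ fun i _ => ?_) hs
  exact (continuous_apply i).continuousAt.mul continuousAt_const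

/-- Here `C` plays the role of `c²`; keeping `h` general covers both the objective gap and the
squared gradient norm. -/
theorem tendsto_rate {lam h q : ι → ℝ} {p : ℕ → ι → ℝ} {a b : ι} {C : ℝ} (hC : 0 < C)
    (hlam : ∀ i, 0 < lam i) (hh : ∀ i, 0 < h i) (hab : a ≠ b)
    (hz : ∀ k, k ≠ a → k ≠ b → q k = 0) (hqa : q a = 1 / (1 + C)) (hqb : q b = C / (1 + C))
    (hlim : Tendsto p atTop (𝓝 q)) :
    Tendsto (fun n => rate lam h (p n)) atTop (𝓝 (C * (h a * C + h b) * (lam b - lam a) ^ 2 /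
      ((lam a + C * lam b) ^ 2 * (h a + C * h b)))) := by
  have := hlam a
  have := hlam b
  have := hh a
  have := hh b
  have hm : mean lam q = (lam a + C * lam b) / (1 + C) := by
    rw [mean, sum_eq_add_of_support hab hz, hqa, hqb]; ring
  have hs : ∑ i, q i * h i = (h a + C * h b) / (1 + C) := by
    rw [sum_eq_add_of_support hab hz, hqa, hqb]; ring
  have hval : rate lam h q = C * (h a * C + h b) * (lam b - lam a) ^ 2 /
      ((lam a + C * lam b) ^ 2 * (h a + C * h b)) := by
    rw [rate, hs, sum_eq_add_of_support hab hz, hm, hqa, hqb]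
    have : lam a + C * lam b ≠ 0 := by positivity
    have : h a + C * h b ≠ 0 := by positivity
    have : 1 + C ≠ 0 := by positivity
    field_simp
    ring
  rw [← hval]
  refine (continuousAt_rate ?_ ?_).tendsto.comp hlim
  · rw [hm]; positivity
  · rw [hs]; positivity

theorem tendsto_of_even_of_odd {X : Type*} [TopologicalSpace X] {u : ℕ → X} {l : X}
    (he : Tendsto (fun n => u (2 * n)) atTop (𝓝 l))
    (ho : Tendsto (fun n => u (2 * n + 1)) atTop (𝓝 l)) : Tendsto u atTop (𝓝 l) := by
  intro s hs
  obtain ⟨M, hM⟩ := eventually_atTop.1 ((he.eventually hs).and (ho.eventually hs))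
  refine eventually_atTop.2 ⟨2 * M, fun n hn => ?_⟩
  rcases Nat.even_or_odd' n with ⟨k, rfl | rfl⟩
  · exact (hM k (by omega)).1
  · exact (hM k (by omega)).2

/-! ### The method in the eigenbasis -/

section Eigenbasis

variable {N : ℕ} {A : Matrix (Fin N) (Fin N) ℝ} {lam : Fin N → ℝ}
  {v : OrthonormalBasis (Fin N) ℝ (EuclideanSpace ℝ (Fin N))}

theorem act_eq_toEuclideanLin (A : Matrix (Fin N) (Fin N) ℝ) (x : EuclideanSpace ℝ (Fin N)) :
    act A x = Matrix.toEuclideanLin A x := rfl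

theorem act_sq (A : Matrix (Fin N) (Fin N) ℝ) (x : EuclideanSpace ℝ (Fin N)) :
    act (A ^ 2) x = act A (act A x) := by
  simp [act, pow_two]

theorem inner_eq_sum_repr (v : OrthonormalBasis (Fin N) ℝ (EuclideanSpace ℝ (Fin N)))
    (x y : EuclideanSpace ℝ (Fin N)) : inner ℝ x y = ∑ i, v.repr x i * v.repr y i := by
  rw [← v.repr.inner_map_map, PiLp.inner_apply]
  exact Finset.sum_congr rfl fun i _ => by simp [mul_comm]

theorem repr_act (hv : ∀ i, act A (v i) = lam i • v i) (x : EuclideanSpace ℝ (Fin N))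
    (i : Fin N) : v.repr (act A x) i = lam i * v.repr x i := by
  have h : act A x = ∑ j, (lam j * v.repr x j) • v j := by
    conv_lhs => rw [← v.sum_repr x]
    rw [act_eq_toEuclideanLin, map_sum]
    refine Finset.sum_congr rfl fun j _ => ?_
    rw [map_smul, ← act_eq_toEuclideanLin, hv, smul_smul, mul_comm]
  rw [h, map_sum]
  simp [Finset.sum_apply, v.repr_self, Pi.single_apply]

theorem eigenvalue_pos (hA : A.PosDef) (hv : ∀ i, act A (v i) = lam i • v i) (i : Fin N) :
    0 < lam i := by
  have h1 := hA.dotProduct_mulVec_pos (x := (v i).ofLp) (by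
    intro h
    have h2 : v i = 0 := by ext k; exact congrFun h k
    simpa [h2] using v.orthonormal.1 i)
  have h3 : inner ℝ (v i) (act A (v i)) = lam i := by
    rw [hv, inner_smul_right, real_inner_self_eq_norm_sq, v.orthonormal.1 i]; simp
  rw [← h3, act, PiLp.inner_apply]
  simpa [dotProduct, mul_comm] using h1

theorem repr_grad_mgStep (hv : ∀ i, act A (v i) = lam i • v i)
    (b x : EuclideanSpace ℝ (Fin N)) (i : Fin N) :
    v.repr (grad A b (x - mgStep A (grad A b x) • grad A b x)) i =
      mgCoord lam (v.repr (grad A b x)) i := by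
  have hstep : mgStep A (grad A b x) = (∑ j, lam j * v.repr (grad A b x) j ^ 2) /
      ∑ j, lam j ^ 2 * v.repr (grad A b x) j ^ 2 := by
    rw [mgStep, act_sq, inner_eq_sum_repr v, inner_eq_sum_repr v]
    simp only [repr_act hv]
    congr 1 <;> exact Finset.sum_congr rfl fun j _ => by ring
  have hlin : ∀ t : ℝ, grad A b (x - t • grad A b x) = grad A b x - t • act A (grad A b x) := by
    intro t
    conv_lhs => rw [grad, act_eq_toEuclideanLin, map_sub, map_smul]
    simp only [← act_eq_toEuclideanLin]
    conv_rhs => rw [grad]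
    unfold grad
    abel
  rw [hlin, map_sub, map_smul, PiLp.sub_apply, PiLp.smul_apply, repr_act hv, mgCoord, ← hstep,
    smul_eq_mul]
  ring

theorem objective_sub_objective (hlam : ∀ i, 0 < lam i) (hv : ∀ i, act A (v i) = lam i • v i)
    {b xstar : EuclideanSpace ℝ (Fin N)} (hxstar : act A xstar = b)
    (x : EuclideanSpace ℝ (Fin N)) :
    objective A b x - objective A b xstar =
      ∑ i, 1 / (2 * lam i ^ 2) * (lam i * v.repr (grad A b x) i ^ 2) := by
  subst hxstar
  simp only [objective, inner_eq_sum_repr v, grad, map_sub, PiLp.sub_apply, repr_act hv,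
    Finset.mul_sum, ← Finset.sum_sub_distrib]
  refine Finset.sum_congr rfl fun i _ => ?_
  have := (hlam i).ne'
  field_simp
  ring

theorem norm_sq_eq_sum (hlam : ∀ i, 0 < lam i)
    (v : OrthonormalBasis (Fin N) ℝ (EuclideanSpace ℝ (Fin N))) (y : EuclideanSpace ℝ (Fin N)) :
    ‖y‖ ^ 2 = ∑ i, 1 / lam i * (lam i * v.repr y i ^ 2) := by
  rw [← real_inner_self_eq_norm_sq, inner_eq_sum_repr v]
  refine Finset.sum_congr rfl fun i _ => ?_
  have := (hlam i).ne'
  field_simp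

end Eigenbasis

end MinimalGradient

/-! ### Assembly of the limits -/

open MinimalGradient in
theorem theorem2 (N : ℕ) (hN : 2 ≤ N)
    (A : Matrix (Fin N) (Fin N) ℝ) (hA : A.PosDef)
    (b : EuclideanSpace ℝ (Fin N))
    (lam : Fin N → ℝ) (hlam : StrictMono lam)
    (v : OrthonormalBasis (Fin N) ℝ (EuclideanSpace ℝ (Fin N)))
    (hv : ∀ i, MinimalGradient.act A (v i) = lam i • v i)
    (xstar : EuclideanSpace ℝ (Fin N)) (hxstar : MinimalGradient.act A xstar = b)
    (x : ℕ → EuclideanSpace ℝ (Fin N)) (hx : MinimalGradient.IsMGSequence A b x)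
    (g : ℕ → EuclideanSpace ℝ (Fin N)) (hg : ∀ n, g n = MinimalGradient.grad A b (x n))
    (hfirst : v.repr (g 0) ⟨0, by omega⟩ ≠ 0)
    (hlast : v.repr (g 0) ⟨N - 1, by omega⟩ ≠ 0)
    (f : EuclideanSpace ℝ (Fin N) → ℝ) (hf : f = MinimalGradient.objective A b)
    (κ : ℝ) (hκ : κ = lam ⟨N - 1, by omega⟩ / lam ⟨0, by omega⟩) :
    ∃ c : ℝ, c ≠ 0 ∧ MinimalGradient.IsSpectralConstant lam v g c ∧
      Tendsto (fun n : ℕ => (f (x (2 * n + 1)) - f xstar) / (f (x (2 * n)) - f xstar)) atTop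
        (𝓝 (c ^ 2 * (1 + c ^ 2 * κ ^ 2) * (κ - 1) ^ 2 /
          ((c ^ 2 + κ ^ 2) * (1 + c ^ 2 * κ) ^ 2))) ∧
      Tendsto (fun n : ℕ => (f (x (2 * n + 2)) - f xstar) / (f (x (2 * n + 1)) - f xstar)) atTop
        (𝓝 (c ^ 2 * (c ^ 2 + κ ^ 2) * (κ - 1) ^ 2 /
          ((1 + c ^ 2 * κ ^ 2) * (c ^ 2 + κ) ^ 2))) ∧
      ∃ L : ℝ,
        Tendsto (fun n : ℕ => (f (x (2 * n + 2)) - f xstar) / (f (x (2 * n)) - f xstar)) atTop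
          (𝓝 L) ∧
        Tendsto (fun n : ℕ => ‖g (n + 1)‖ ^ 4 / ‖g n‖ ^ 4) atTop (𝓝 L) := by
  have hpos := eigenvalue_pos hA hv
  set s : Fin N := ⟨0, by omega⟩ with hs_def
  set t : Fin N := ⟨N - 1, by omega⟩ with ht_def
  have hst : s < t := by rw [hs_def, ht_def, Fin.mk_lt_mk]; omega
  have hls : ∀ k, lam s ≤ lam k := fun k => hlam.monotone (by
    rw [hs_def, Fin.le_def]; exact Nat.zero_le _)
  have hlt : ∀ k, lam k ≤ lam t := fun k => hlam.monotone (by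
    rw [ht_def, Fin.le_def]; show k.val ≤ N - 1; omega)
  have hlst := hlam hst
  have hrec : ∀ n, (v.repr (g (n + 1))).ofLp = mgCoord lam (v.repr (g n)) := by
    intro n
    ext i
    rw [hg, hg, hx n, repr_grad_mgStep hv]
  have hmean : ∀ z : Fin N → ℝ, z s ≠ 0 → z t ≠ 0 →
      mean lam (weight lam z) ∈ Set.Ioo (lam s) (lam t) := fun z h1 h2 =>
    mean_mem_Ioo hlst hls hlt (weight_nonneg hpos) (sum_weight (sum_mul_sq_pos hpos h1).ne')
      (weight_pos hpos h1) (weight_pos hpos h2)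
  -- The mean lies strictly between the extreme eigenvalues, so neither extreme factor `1 - λ / m`
  -- vanishes.
  have hne : ∀ n, v.repr (g n) s ≠ 0 ∧ v.repr (g n) t ≠ 0 := by
    intro n
    induction n with
    | zero => exact ⟨hfirst, hlast⟩
    | succ n ih =>
      obtain ⟨h1, h2⟩ := hmean _ ih.1 ih.2
      have h0 := (hpos s).trans h1
      rw [hrec, mgCoord_eq, mgCoord_eq]
      refine ⟨mul_ne_zero ?_ ih.1, mul_ne_zero ?_ ih.2⟩
      · rw [sub_ne_zero, ne_comm, Ne, div_eq_one_iff_eq h0.ne']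
        exact h1.ne
      · rw [sub_ne_zero, ne_comm, Ne, div_eq_one_iff_eq h0.ne']
        exact h2.ne'
  have hW : ∀ n, ∑ j, lam j * (v.repr (g n)).ofLp j ^ 2 ≠ 0 := fun n =>
    (sum_mul_sq_pos hpos (hne n).1).ne'
  set p : ℕ → Fin N → ℝ := fun n => weight lam (v.repr (g n)) with hp_def
  obtain ⟨q, hqs, hqt, hqsum, hqz, hTs, hTt, heven, hodd⟩ :=
    exists_tendsto_reweight (p := p) hlam.injective hlst hls hlt
      (fun n => by
        rw [hp_def]
        simp only [hrec]
        exact weight_mgCoord (hW n) ((hpos s).trans (hmean _ (hne n).1 (hne n).2).1).ne')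
      (fun n => weight_nonneg hpos) (fun n => sum_weight (hW n))
      (fun n => weight_pos hpos (hne n).1) (fun n => weight_pos hpos (hne n).2)
  have hTz : ∀ k, k ≠ s → k ≠ t → reweight lam q k = 0 := fun k h1 h2 => by
    rw [reweight, hqz k h1 h2]; simp
  set C : ℝ := q t / q s with hC_def
  have hC : 0 < C := div_pos hqt hqs
  have hqsC : q s = 1 / (1 + C) := by
    rw [hC_def, one_add_div hqs.ne', hqsum]; simp
  have hqtC : q t = C / (1 + C) := by
    rw [hC_def, one_add_div hqs.ne', hqsum]; field_simp
  have hratio : ∀ h : Fin N → ℝ, ∀ n,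
      (∑ i, h i * (lam i * v.repr (g (n + 1)) i ^ 2)) / ∑ i, h i * (lam i * v.repr (g n) i ^ 2) =
        rate lam h (p n) := by
    intro h n
    rw [hrec]
    exact sum_mgCoord_div_sum (hW n) h
  have hreven := fun h hh => tendsto_rate (h := h) hC hpos hh hst.ne hqz hqsC hqtC heven
  -- Swapping the two limiting weights amounts to replacing `C` by `C⁻¹`.
  have hrodd := fun h hh => tendsto_rate (h := h) (inv_pos.2 hC) hpos hh hst.ne hTz
    (by rw [hTs, hqtC]; field_simp; ring) (by rw [hTt, hqsC]; field_simp; ring) hodd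
  have hfval : ∀ n, f (x n) - f xstar =
      ∑ i, 1 / (2 * lam i ^ 2) * (lam i * v.repr (g n) i ^ 2) := by
    intro n
    rw [hf, objective_sub_objective hpos hv hxstar, hg]
  have hfne : ∀ n, f (x n) - f xstar ≠ 0 := by
    intro n
    rw [hfval]
    refine (Finset.sum_pos' (fun i _ => ?_) ⟨s, Finset.mem_univ _, ?_⟩).ne'
    · have := hpos i; positivity
    · have := hpos s
      have := (hne n).1
      positivity
  have hhf : ∀ i, 0 < 1 / (2 * lam i ^ 2) := fun i => by have := hpos i; positivity
  have hhg : ∀ i, 0 < 1 / lam i := fun i => one_div_pos.2 (hpos i)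
  have hκt : lam t = κ * lam s := by rw [hκ]; field_simp [(hpos s).ne']
  have hs0 := hpos s
  have hκ0 : 0 < κ := by rw [hκ]; exact div_pos (hpos t) hs0
  have hF1 : Tendsto (fun n : ℕ => (f (x (2 * n + 1)) - f xstar) / (f (x (2 * n)) - f xstar)) atTop
      (𝓝 (C * (1 + C * κ ^ 2) * (κ - 1) ^ 2 / ((C + κ ^ 2) * (1 + C * κ) ^ 2))) := by
    have := hreven _ hhf
    simp only [← hratio, ← hfval] at this
    convert this using 2
    rw [hκt]
    field_simp
    ring
  have hF2 : Tendsto (fun n : ℕ => (f (x (2 * n + 2)) - f xstar) / (f (x (2 * n + 1)) - f xstar))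
      atTop (𝓝 (C * (C + κ ^ 2) * (κ - 1) ^ 2 / ((1 + C * κ ^ 2) * (C + κ) ^ 2))) := by
    have := hrodd _ hhf
    simp only [← hratio, ← hfval] at this
    convert this using 2
    rw [hκt]
    field_simp
    ring
  -- This limit is invariant under `C ↦ C⁻¹`, so the even and odd subsequences agree.
  have hG : Tendsto (fun n : ℕ => ‖g (n + 1)‖ ^ 2 / ‖g n‖ ^ 2) atTop
      (𝓝 (C * (κ - 1) ^ 2 / ((1 + C * κ) * (C + κ)))) := by
    simp only [norm_sq_eq_sum hpos v, hratio]
    refine tendsto_of_even_of_odd ?_ ?_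
    · convert hreven _ hhg using 2
      rw [hκt]
      field_simp
      ring
    · convert hrodd _ hhg using 2
      rw [hκt]
      field_simp
      ring
  have hsq : Real.sqrt C ^ 2 = C := Real.sq_sqrt hC.le
  refine ⟨Real.sqrt C, (Real.sqrt_pos.2 hC).ne', ?_, ?_⟩
  · have hlim : ∀ (r : Fin N → ℝ) (y z : ℝ), r s = y → r t = z →
        (∀ k, k ≠ s → k ≠ t → r k = 0) → ∀ i : Fin N,
        (if i.val = 0 then y else if i.val = N - 1 then z else 0) = r i := by
      intro r y z h1 h2 h3 i
      split_ifs with h4 h5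
      · rw [← h1]; congr 1; exact Fin.ext h4.symm
      · rw [← h2]; congr 1; exact Fin.ext h5.symm
      · exact (h3 i (fun e => h4 (congrArg Fin.val e)) (fun e => h5 (congrArg Fin.val e))).symm
    constructor
    · intro i
      rw [hsq, hlim q _ _ hqsC hqtC hqz]
      exact (continuous_apply i).continuousAt.tendsto.comp heven
    · intro i
      rw [hsq, hlim (reweight lam q) _ _ (hTs.trans hqtC) (hTt.trans hqsC) hTz]
      exact (continuous_apply i).continuousAt.tendsto.comp hodd
  · rw [hsq]
    -- In the product of the two objective limits `C + κ²` and `1 + C κ²` cancel, leaving the square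
    -- of the limit in `hG`.
    refine ⟨hF1, hF2, (C * (κ - 1) ^ 2 / ((1 + C * κ) * (C + κ))) ^ 2, ?_, ?_⟩
    · convert hF2.mul hF1 using 2 with n
      · rw [div_mul_div_cancel₀ (hfne _)]
      · field_simp
    · refine (hG.pow 2).congr fun n => ?_
      rw [div_pow, ← pow_mul, ← pow_mul]
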